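/- For $n\ge 0$, an $n\times n$ black-white image is a map $f\colon[n]\times[n]\to\{\text{white},\text{black}\}$. A property $\mathcal P$ is a collection of such images (of all sizes $n$). Two pixels are neighbors if they share one coordinate and differ by one in the other; the boundary of an image is the set of black pixels that have a white neighbor. $\mathcal P$ has a $c$-sparse boundary if every $n\times n$ image in $\mathcal P$ (for every $n$) has at most $cn$ boundary pixels. Represent an image $f$ by the edge-colored complete ordered graph $g_f$ on the vertices $1,\dots,2n$ (the $n$ rows followed by the $n$ columns), where the pair $\{x,n+y\}$ with $x,y\in[n]$ has color $f(x,y)$ and all other pairs have one extra "no edge" color. A basic move in an edge-colored ordered graph swaps two consecutive vertices. The earthmover distance $d_e(f,f')$ of two $n\times n$ images is the minimum number of basic moves that turn $g_f$ into $g_{f'}$ ($+\infty$ if impossible), divided by $\binom{2n}{2}$ (for $n=0$ it is $0$). For $\delta\colon(0,1)\to(0,1)$, $\mathcal P$ is $\delta$-earthmover resilient if for all $\epsilon\in(0,1)$, all $n$, every $n\times n$ image $f\in\mathcal P$ and every $n\times n$ image $f'$ with $d_e(f,f')\le\delta(\epsilon)$, there is an $n\times n$ image $h\in\mathcal P$ that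 differs from $f'$ in at most $\epsilon n^2$ pixels. $\mathcal P$ is earthmover resilient if it is $\delta$-earthmover resilient for some $\delta\colon(0,1)\to(0,1)$ (not depending on $n$). An image is convex if every pixel that lies (as a point of $\mathbb Z^2\subset\mathbb R^2$) in the convex hull of the black pixels is black. An image is a half-plane if for some $(a,b)\in\mathbb R^2\setminus\{(0,0)\}$ and $t\in\mathbb R$ its black pixels are exactly the pixels $(x,y)$ with $ax+by\ge t$. **Theorem.** There is an absolute constant $\alpha>0$ such that for every real $c\ge1$ and every property $\mathcal P$ of black-white images with a $c$-sparse boundary, $\mathcal P$ is $\delta$-earthmover resilient for every $\delta\colon(0,1)\to(0,1)$ that satisfies $\delta(\epsilon)\le\alpha\epsilon^2/c^2$ for all $\epsilon\in(0,1)$. In particular, the property of being convex and the property of being a half-plane each have a $4$-sparse boundary and are earthmover resilient. -/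

import Mathlib

open scoped ENNReal

/-! ### Functions on `k`-subsets of `[n]`, basic moves, earthmover distance -/

/-- The `k`-element subsets of the ordered set `[n]`. -/
abbrev KSubset (n k : ℕ) : Type := {s : Finset (Fin n) // s.card = k}

/-- The positions at which a basic move can be made: `x ∈ [n]` such that `x + 1 ∈ [n]`. -/
abbrev MovePos (n : ℕ) : Type := {x : Fin n // x.val + 1 < n}

/-- The permutation of `[n]` that swaps `x` and `x + 1` and fixes everything else. -/
def adjSwap {n : ℕ} (x : MovePos n) : Equiv.Perm (Fin n) :=
  Equiv.swap x.1 ⟨x.1.val + 1, x.2⟩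

/-- The map on `k`-subsets induced by a permutation of `[n]`. -/
def permKSubset {n k : ℕ} (σ : Equiv.Perm (Fin n)) (s : KSubset n k) : KSubset n k :=
  ⟨s.1.map σ.toEmbedding, by rw [Finset.card_map]; exact s.2⟩

/-- The result of a basic move between `x` and `x + 1` in `f`. -/
def basicMove {n k : ℕ} {C : Type*} (f : KSubset n k → C) (x : MovePos n) : KSubset n k → C :=
  fun s => f (permKSubset (adjSwap x) s)

/-- The absolute earthmover distance: the minimum length of a sequence of basic moves that
produces `f'` from `f`, and `⊤` if there is no such sequence. -/
noncomputable def absEarthmoverDist {n k : ℕ} {C : Type*} (f f' : KSubset n k → C) : ℕ∞ :=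
  ⨅ (L : List (MovePos n)) (_ : L.foldl basicMove f = f'), (L.length : ℕ∞)

/-- The normalized earthmover distance. For `n ≤ 1` there are no basic moves, and the value is
`0` if `f = f'` and `⊤` otherwise. -/
noncomputable def earthmoverDist {n k : ℕ} {C : Type*} (f f' : KSubset n k → C) : ℝ≥0∞ :=
  (absEarthmoverDist f f' : ℝ≥0∞) / (n.choose 2 : ℝ≥0∞)

/-! ### Images and their representation as ordered graphs -/

/-- An `n × n` image with colours in `C`; `f (i, j)` is the colour of the pixel in row `i` and
column `j`. -/
abbrev Image (n : ℕ) (C : Type*) : Type _ := Fin n × Fin n → C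

/-- The edge-coloured ordered graph on `[2n]` that represents an `n × n` image: the first `n`
vertices are the rows, the last `n` vertices are the columns, the pair of row `x` and column `y`
has the colour of the pixel `(x, y)`, and pairs of rows and pairs of columns have the extra
colour `none`. -/
def Image.toGraph {n : ℕ} {C : Type*} (f : Image n C) (s : KSubset (n + n) 2) : Option C :=
  have hs : s.1.Nonempty := Finset.card_pos.mp (by rw [s.2]; exact Nat.succ_pos 1)
  if h : (s.1.min' hs).val < n ∧ n ≤ (s.1.max' hs).val then
    some (f (⟨(s.1.min' hs).val, h.1⟩,
      ⟨(s.1.max' hs).val - n, by have := (s.1.max' hs).isLt; omega⟩))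
  else none

theorem Image.toGraph_row_col {n : ℕ} {C : Type*} (f : Image n C) (x y : Fin n)
    (s : KSubset (n + n) 2) (hs : s.1 = {Fin.castAdd n x, Fin.natAdd n y}) :
    f.toGraph s = some (f (x, y)) := by
  obtain ⟨s, hc⟩ := s
  simp only at hs
  subst hs
  have h1 : min x.val (y.val + n) = x.val := by have := x.isLt; omega
  have h2 : max x.val (y.val + n) - n = y.val := by have := x.isLt; omega
  simp [Image.toGraph, h1, h2]

/-- The earthmover distance between two images is that of the graphs that represent them. -/
noncomputable def Image.earthmoverDist {n : ℕ} {C : Type*} (f f' : Image n C) : ℝ≥0∞ :=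
  _root_.earthmoverDist f.toGraph f'.toGraph

/-- The relative Hamming distance between two images. -/
noncomputable def Image.relHammingDist {n : ℕ} {C : Type*} [DecidableEq C] (f f' : Image n C) :
    ℝ :=
  (hammingDist f f' : ℝ) / (Fintype.card (Fin n × Fin n) : ℝ)

/-! ### Properties of images and earthmover resilience -/

/-- A property of square images: for every `n`, a set of `n × n` images. -/
abbrev ImageProperty (C : Type*) : Type _ := (n : ℕ) → Set (Image n C)

/-- `f` is `ε`-close to the property `P` in the relative Hamming distance. -/
def ImageProperty.IsClose {C : Type*} [DecidableEq C] (P : ImageProperty C) (ε : ℝ) {n : ℕ}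
    (f : Image n C) : Prop :=
  ∃ g ∈ P n, f.relHammingDist g ≤ ε

/-- `P` is `δ`-earthmover resilient, for a function `δ : (0,1) → (0,1)`. -/
def ImageProperty.IsEarthmoverResilientWith {C : Type*} [DecidableEq C]
    (δ : Set.Ioo (0 : ℝ) 1 → Set.Ioo (0 : ℝ) 1) (P : ImageProperty C) : Prop :=
  ∀ (ε : Set.Ioo (0 : ℝ) 1) (n : ℕ), ∀ f ∈ P n, ∀ f' : Image n C,
    f.earthmoverDist f' ≤ ENNReal.ofReal (δ ε : ℝ) → P.IsClose (ε : ℝ) f'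

/-- `P` is earthmover resilient: it is `δ`-earthmover resilient for some `δ : (0,1) → (0,1)`. -/
def ImageProperty.IsEarthmoverResilient {C : Type*} [DecidableEq C] (P : ImageProperty C) :
    Prop :=
  ∃ δ : Set.Ioo (0 : ℝ) 1 → Set.Ioo (0 : ℝ) 1, P.IsEarthmoverResilientWith δ

/-! ### Black-white images (`true` is black, `false` is white) and sparse boundaries -/

/-- Two pixels are neighbours if they share one coordinate and differ by one in the other. -/
def PixelNeighbor {n : ℕ} (p q : Fin n × Fin n) : Prop :=
  (p.1 = q.1 ∧ (p.2.val + 1 = q.2.val ∨ q.2.val + 1 = p.2.val)) ∨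
  (p.2 = q.2 ∧ (p.1.val + 1 = q.1.val ∨ q.1.val + 1 = p.1.val))

/-- The boundary of a black-white image: the black pixels that have a white neighbour. -/
def Image.boundary {n : ℕ} (f : Image n Bool) : Set (Fin n × Fin n) :=
  {p | f p = true ∧ ∃ q, PixelNeighbor p q ∧ f q = false}

/-- `P` has a `c`-sparse boundary: every `n × n` image that satisfies `P` has at most `c * n`
boundary pixels. -/
def ImageProperty.HasSparseBoundary (c : ℝ) (P : ImageProperty Bool) : Prop :=
  ∀ (n : ℕ), ∀ f ∈ P n, (f.boundary.ncard : ℝ) ≤ c * (n : ℝ)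

/-! ### Convexity and being a half-plane -/

/-- The point of the plane at which a pixel lies. -/
def pixelPoint {n : ℕ} (p : Fin n × Fin n) : ℝ × ℝ := ((p.1.val : ℝ), (p.2.val : ℝ))

/-- Convexity: every pixel in the convex hull of the black pixels is black. -/
def convexImages : ImageProperty Bool := fun _ =>
  {f | ∀ q, pixelPoint q ∈ convexHull ℝ (pixelPoint '' {p | f p = true}) → f q = true}

/-- Being a half-plane: the black pixels are exactly those in some closed half-plane. -/
def halfPlaneImages : ImageProperty Bool := fun _ =>
  {f | ∃ a b t : ℝ, (a, b) ≠ (0, 0) ∧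
    ∀ p, f p = true ↔ t ≤ a * (pixelPoint p).1 + b * (pixelPoint p).2}

/-! The image `f` itself is the witness of closeness. A sequence of `m` basic moves composes to a
permutation of the `2n` vertices with total displacement `D ≤ 2m`. The colour `none` marks pairs on
one side, so the permutation either preserves rows and columns or exchanges them, and exchanging
costs at least `n²/2`. For small `D`, therefore, `f' (x, y) = f (r x, c y)`, where `r` and `c` have
total displacement `D` together (`Image.exists_maps_of_toGraph_eq`).

Fix a threshold `t`. At most `D / t` rows and columns move further than `t`, and each of them spoils
at most `n` pixels. A pixel whose colour changes under a shorter move has a boundary pixel within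
distance `t` on its line, and each boundary pixel is blamed `O(t)` times in each direction
(`Image.card_row_changes_le`). With at most `c * n` boundary pixels the change is `O(t * c * n + D *
n / t)`, and `t` proportional to `ε * n / c` makes it at most `ε * n²`.

In a convex image the black pixels of a line form an interval, which has at most two ends; summing
over the `2n` lines bounds the boundary by `4n`. -/

/-! ### Sequences of basic moves as permutations of small total displacement -/

/-- The total displacement of a self-map of `[n]`. -/
def totalDisplacement {n : ℕ} (s : Fin n → Fin n) : ℤ :=
  ∑ i, |((s i).val : ℤ) - (i.val : ℤ)|

theorem totalDisplacement_adjSwap_le {n : ℕ} (x : MovePos n) :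
    totalDisplacement (adjSwap x) ≤ 2 := by
  obtain ⟨x, hx⟩ := x
  set y : Fin n := ⟨x.val + 1, hx⟩ with hy
  have hxy : x ≠ y := by
    intro h
    have := congrArg Fin.val h
    simp [hy] at this
  have hsub : totalDisplacement (adjSwap ⟨x, hx⟩)
      = ∑ i ∈ ({x, y} : Finset (Fin n)), |((Equiv.swap x y i).val : ℤ) - (i.val : ℤ)| := by
    symm
    apply Finset.sum_subset (Finset.subset_univ _)
    intro i _ hi
    simp only [Finset.mem_insert, Finset.mem_singleton, not_or] at hi
    rw [Equiv.swap_apply_of_ne_of_ne hi.1 hi.2]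
    simp
  rw [hsub, Finset.sum_pair hxy, Equiv.swap_apply_left, Equiv.swap_apply_right]
  simp [hy]

theorem totalDisplacement_mul_le {n : ℕ} (σ τ : Equiv.Perm (Fin n)) :
    totalDisplacement (σ * τ) ≤ totalDisplacement σ + totalDisplacement τ := by
  unfold totalDisplacement
  rw [← Equiv.sum_comp τ (fun i => |((σ i).val : ℤ) - (i.val : ℤ)|), ← Finset.sum_add_distrib]
  exact Finset.sum_le_sum fun i _ => abs_sub_le _ _ _

theorem permKSubset_mul {n k : ℕ} (σ τ : Equiv.Perm (Fin n)) (s : KSubset n k) :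
    permKSubset (σ * τ) s = permKSubset σ (permKSubset τ s) := by
  apply Subtype.ext
  simp only [permKSubset, Finset.map_map]
  rfl

theorem exists_perm_foldl_basicMove {n k : ℕ} {C : Type*} (f : KSubset n k → C)
    (L : List (MovePos n)) :
    ∃ σ : Equiv.Perm (Fin n), (∀ s, L.foldl basicMove f s = f (permKSubset σ s)) ∧
      totalDisplacement σ ≤ 2 * (L.length : ℤ) := by
  -- A move precomposes with its swap, so the last move is the rightmost factor; hence the induction
  -- from the end of the list.
  induction L using List.reverseRecOn with
  | nil =>
    refine ⟨1, fun s => ?_, by simp [totalDisplacement]⟩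
    have : permKSubset (1 : Equiv.Perm (Fin n)) s = s :=
      Subtype.ext (Finset.map_refl)
    rw [this, List.foldl_nil]
  | append_singleton L x ih =>
    obtain ⟨σ, hσ, hd⟩ := ih
    refine ⟨σ * adjSwap x, fun s => ?_, ?_⟩
    · rw [List.foldl_append, List.foldl_cons, List.foldl_nil, basicMove, hσ, permKSubset_mul]
    · have h1 := totalDisplacement_mul_le σ (adjSwap x)
      have h2 := totalDisplacement_adjSwap_le x
      rw [List.length_append, List.length_singleton, Nat.cast_add, Nat.cast_one]
      linarith

theorem exists_moves_of_earthmoverDist_le {n k : ℕ} {C : Type*} {f f' : KSubset n k → C}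
    {d : ℝ} (hd : 0 ≤ d) (hn : n.choose 2 ≠ 0)
    (h : earthmoverDist f f' ≤ ENNReal.ofReal d) :
    ∃ L : List (MovePos n), L.foldl basicMove f = f' ∧ (L.length : ℝ) ≤ d * (n.choose 2 : ℝ) := by
  unfold earthmoverDist at h
  rw [ENNReal.div_le_iff (by exact_mod_cast hn) (ENNReal.natCast_ne_top _)] at h
  have hlt : absEarthmoverDist f f' ≠ ⊤ := by
    intro htop
    rw [htop] at h
    have : ENNReal.ofReal d * (n.choose 2 : ℝ≥0∞) < ⊤ :=
      ENNReal.mul_lt_top ENNReal.ofReal_lt_top (ENNReal.natCast_lt_top _)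
    simp at h
    exact this.ne h
  obtain ⟨m, hm⟩ := ENat.ne_top_iff_exists.mp hlt
  -- A finite infimum in `ℕ∞` is attained: otherwise `m + 1` would be a lower bound.
  obtain ⟨L, hL, hlen⟩ : ∃ L : List (MovePos n), L.foldl basicMove f = f' ∧ L.length ≤ m := by
    by_contra! hcon
    have : ((m + 1 : ℕ) : ℕ∞) ≤ absEarthmoverDist f f' := by
      refine le_iInf₂ fun L hL => ?_
      exact_mod_cast hcon L hL
    rw [← hm] at this
    have : m + 1 ≤ m := by exact_mod_cast this
    omega
  refine ⟨L, hL, le_trans (by exact_mod_cast hlen) (?_ : (m : ℝ) ≤ _)⟩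
  rw [← hm] at h
  have h' : ENNReal.ofReal (m : ℝ) ≤ ENNReal.ofReal (d * (n.choose 2 : ℝ)) := by
    rw [ENNReal.ofReal_mul hd, ENNReal.ofReal_natCast, ENNReal.ofReal_natCast]
    simpa using h
  exact (ENNReal.ofReal_le_ofReal_iff (by positivity)).mp h'

/-! ### Isomorphisms between the graphs of two images -/

theorem Image.toGraph_pair_ne_none_iff {n : ℕ} {C : Type*} (f : Image n C) {i j : Fin (n + n)}
    (s : KSubset (n + n) 2) (hs : s.1 = {i, j}) :
    f.toGraph s ≠ none ↔ ¬ (i.val < n ↔ j.val < n) := by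
  obtain ⟨s, hc⟩ := s
  simp only at hs
  subst hs
  have : f.toGraph ⟨{i, j}, hc⟩ ≠ none ↔ (min i j).val < n ∧ n ≤ (max i j).val := by
    have hmin : ({i, j} : Finset (Fin (n + n))).min' ⟨i, by simp⟩ = min i j := by simp
    have hmax : ({i, j} : Finset (Fin (n + n))).max' ⟨i, by simp⟩ = max i j := by simp
    rw [← hmin, ← hmax]
    simp only [Image.toGraph]
    split_ifs with h
    · exact iff_of_true (Option.some_ne_none _) h
    · exact iff_of_false (not_not.mpr rfl) h
  rw [this]
  rcases le_total i j with h | h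
  · rw [min_eq_left h, max_eq_right h]
    have : i.val ≤ j.val := h
    omega
  · rw [min_eq_right h, max_eq_left h]
    have : j.val ≤ i.val := h
    omega

theorem permKSubset_pair {n : ℕ} (σ : Equiv.Perm (Fin n)) {i j : Fin n} (s : KSubset n 2)
    (hs : s.1 = {i, j}) : (permKSubset σ s).1 = {σ i, σ j} := by
  simp [permKSubset, hs, Finset.map_insert]

theorem Image.side_iff_of_toGraph_eq {n : ℕ} {C : Type*} {f f' : Image n C}
    {σ : Equiv.Perm (Fin (n + n))} (h : ∀ s, f'.toGraph s = f.toGraph (permKSubset σ s))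
    (i j : Fin (n + n)) :
    (i.val < n ↔ j.val < n) ↔ ((σ i).val < n ↔ (σ j).val < n) := by
  by_cases hij : i = j
  · subst hij; simp
  · have h1 := f'.toGraph_pair_ne_none_iff ⟨{i, j}, Finset.card_pair hij⟩ rfl
    have h2 := f.toGraph_pair_ne_none_iff _
      (permKSubset_pair σ ⟨{i, j}, Finset.card_pair hij⟩ rfl)
    rw [h] at h1
    exact not_iff_not.mp (h1.symm.trans h2)

/-- Row `i` travels at least `n - i`, and these distances sum to `n(n+1)/2`. -/
theorem sq_le_totalDisplacement_of_swap_sides {n : ℕ} {s : Fin (n + n) → Fin (n + n)}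
    (h : ∀ i : Fin (n + n), i.val < n → n ≤ (s i).val) :
    (n : ℤ) ^ 2 ≤ 2 * totalDisplacement s := by
  have h1 : ∑ i : Fin n, ((n : ℤ) - (i.val : ℤ)) ≤ totalDisplacement s := by
    unfold totalDisplacement
    rw [Fin.sum_univ_add]
    refine le_trans (Finset.sum_le_sum fun i _ => ?_)
      (le_add_of_nonneg_right (Finset.sum_nonneg fun i _ => abs_nonneg _))
    have h2 := h (Fin.castAdd n i) (by simp)
    refine le_trans ?_ (le_abs_self _)
    simp only [Fin.val_castAdd]
    omega
  have h3 : ∀ m : ℕ, 2 * ∑ i ∈ Finset.range m, (i : ℤ) = (m : ℤ) ^ 2 - m := by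
    intro m
    induction m with
    | zero => simp
    | succ m ih => rw [Finset.sum_range_succ, mul_add, ih]; push_cast; ring
  rw [Finset.sum_sub_distrib, Fin.sum_univ_eq_sum_range (fun i => (i : ℤ))] at h1
  have := h3 n
  simp at h1
  nlinarith

theorem Image.exists_maps_of_toGraph_eq {n : ℕ} {C : Type*} {f f' : Image n C}
    {σ : Equiv.Perm (Fin (n + n))} (h : ∀ s, f'.toGraph s = f.toGraph (permKSubset σ s))
    (hn : 2 * totalDisplacement σ < (n : ℤ) ^ 2) :
    ∃ r c : Fin n → Fin n, Function.Injective c ∧ (∀ x y, f' (x, y) = f (r x, c y)) ∧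
      totalDisplacement r + totalDisplacement c = totalDisplacement σ := by
  -- One vertex that changes sides forces all vertices to do so, which the displacement bound
  -- forbids.
  have side : ∀ i : Fin (n + n), (σ i).val < n ↔ i.val < n := by
    by_contra! hcon
    obtain ⟨i, hi⟩ := hcon
    refine absurd (sq_le_totalDisplacement_of_swap_sides (s := σ) fun j hj => ?_) (not_le.mpr hn)
    have := Image.side_iff_of_toGraph_eq h i j
    by_contra hlt
    omega
  let r : Fin n → Fin n := fun x => ⟨(σ (Fin.castAdd n x)).val, (side _).mpr (by simp)⟩
  have hc : ∀ y : Fin n, n ≤ (σ (Fin.natAdd n y)).val := fun y => by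
    have := side (Fin.natAdd n y)
    rw [Fin.val_natAdd] at this
    omega
  let c : Fin n → Fin n := fun y => ⟨(σ (Fin.natAdd n y)).val - n, by have := hc y; omega⟩
  have hr' : ∀ x, σ (Fin.castAdd n x) = Fin.castAdd n (r x) := fun x => Fin.ext (by simp [r])
  have hc' : ∀ y, σ (Fin.natAdd n y) = Fin.natAdd n (c y) := fun y => Fin.ext (by
    have := hc y
    rw [Fin.val_natAdd]
    simp only [c]
    omega)
  refine ⟨r, c, fun y y' hyy => ?_, fun x y => ?_, ?_⟩
  · have : σ (Fin.natAdd n y) = σ (Fin.natAdd n y') := by rw [hc', hc', hyy]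
    simpa using this
  · have hne : Fin.castAdd n x ≠ Fin.natAdd n y := by
      intro he
      have := congrArg Fin.val he
      simp at this
      omega
    have e1 := f'.toGraph_row_col x y ⟨_, Finset.card_pair hne⟩ rfl
    rw [h, f.toGraph_row_col (r x) (c y) _ (by
      rw [permKSubset_pair σ ⟨_, Finset.card_pair hne⟩ rfl, hr', hc'])] at e1
    exact (Option.some.inj e1).symm
  · unfold totalDisplacement
    rw [Fin.sum_univ_add]
    congr 1
    · simp only [hc', Fin.val_natAdd]
      push_cast
      simp

/-! ### Counting the pixels that change when rows or columns are moved -/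

theorem exists_consecutive_ne {n : ℕ} (g : Fin n → Bool) {a b : Fin n} (hab : a ≤ b)
    (h : g a ≠ g b) :
    ∃ i j : Fin n, i.val + 1 = j.val ∧ a ≤ i ∧ j ≤ b ∧ g i ≠ g j := by
  by_contra! hcon
  have key : ∀ k : ℕ, ∀ hk : a.val + k < n, a.val + k ≤ b.val → g ⟨a.val + k, hk⟩ = g a := by
    intro k
    induction k with
    | zero => intro hk _; rfl
    | succ k ih =>
      intro hk hkb
      rw [← ih (by omega) (by omega)]
      symm
      exact hcon ⟨a.val + k, by omega⟩ ⟨a.val + (k + 1), hk⟩ (by simp; omega)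
        (by rw [Fin.le_def]; simp) (by rw [Fin.le_def]; exact hkb)
  have hab' : a.val ≤ b.val := hab
  have hb : (⟨a.val + (b.val - a.val), by omega⟩ : Fin n) = b := Fin.ext (by simp; omega)
  have := key (b.val - a.val) (by omega) (by omega)
  rw [hb] at this
  exact h this.symm

/-- Somewhere between the two pixels the colour changes in one step; the black pixel of that step is
on the boundary. -/
theorem Image.exists_boundary_between {n : ℕ} (f : Image n Bool) {a b y : Fin n}
    (h : f (a, y) ≠ f (b, y)) :
    ∃ p ∈ f.boundary, p.2 = y ∧ min a b ≤ p.1 ∧ p.1 ≤ max a b := by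
  wlog hab : a ≤ b generalizing a b
  · obtain ⟨p, hp, hy, h1, h2⟩ := this h.symm (le_of_not_ge hab)
    exact ⟨p, hp, hy, by rwa [min_comm], by rwa [max_comm]⟩
  rw [min_eq_left hab, max_eq_right hab]
  obtain ⟨i, j, hij, hai, hjb, hne⟩ := exists_consecutive_ne (fun x => f (x, y)) hab h
  have hle : i ≤ j := by rw [Fin.le_def]; omega
  cases hi : f (i, y) with
  | true =>
    refine ⟨(i, y), ⟨hi, (j, y), Or.inr ⟨rfl, Or.inl hij⟩, ?_⟩, rfl, hai, hle.trans hjb⟩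
    simpa [hi] using hne
  | false =>
    refine ⟨(j, y), ⟨?_, (i, y), Or.inr ⟨rfl, Or.inr hij⟩, hi⟩, rfl, hai.trans hle, hjb⟩
    simpa [hi] using hne

theorem card_filter_abs_sub_le {n : ℕ} (b : Fin n) {t : ℝ} (ht : 0 ≤ t) :
    ((Finset.univ.filter fun x : Fin n => |(x.val : ℝ) - (b.val : ℝ)| ≤ t).card : ℝ)
      ≤ 2 * t + 1 := by
  have h : (Finset.univ.filter fun x : Fin n => |(x.val : ℝ) - (b.val : ℝ)| ≤ t).card
      ≤ (Finset.Icc ((b.val : ℤ) - ⌊t⌋) ((b.val : ℤ) + ⌊t⌋)).card := by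
    refine Finset.card_le_card_of_injOn (fun x => (x.val : ℤ)) (fun x hx => ?_) fun x _ y _ h => ?_
    · simp only [Finset.coe_filter, Finset.mem_univ, true_and, Set.mem_ofPred_eq] at hx
      have h1 : |(x.val : ℤ) - (b.val : ℤ)| ≤ ⌊t⌋ := by
        rw [Int.le_floor]; push_cast; exact hx
      rw [abs_le] at h1
      simp only [Finset.coe_Icc, Set.mem_Icc]
      constructor <;> linarith [h1.1, h1.2]
    · exact Fin.ext (Int.ofNat_inj.mp h)
  have h0 : 0 ≤ ⌊t⌋ := Int.floor_nonneg.mpr ht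
  rw [Int.card_Icc] at h
  have h2 : ((Finset.univ.filter fun x : Fin n => |(x.val : ℝ) - (b.val : ℝ)| ≤ t).card : ℤ)
      ≤ 2 * ⌊t⌋ + 1 := by omega
  have h3 : ((Finset.univ.filter fun x : Fin n => |(x.val : ℝ) - (b.val : ℝ)| ≤ t).card : ℝ)
      ≤ 2 * (⌊t⌋ : ℝ) + 1 := by exact_mod_cast h2
  linarith [Int.floor_le t]

/-- Markov's inequality. -/
theorem card_filter_lt_displacement {n : ℕ} (s : Fin n → Fin n) {t : ℝ} (ht : 0 < t) :
    ((Finset.univ.filter fun x : Fin n => t < |((s x).val : ℝ) - (x.val : ℝ)|).card : ℝ)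
      ≤ totalDisplacement s / t := by
  rw [le_div_iff₀ ht, ← nsmul_eq_mul]
  refine le_trans (Finset.card_nsmul_le_sum _
    (fun x : Fin n => |((s x).val : ℝ) - (x.val : ℝ)|) t fun x hx => ?_) ?_
  · exact (Finset.mem_filter.mp hx).2.le
  · unfold totalDisplacement
    push_cast
    exact Finset.sum_le_sum_of_subset_of_nonneg (Finset.filter_subset _ _)
      fun i _ _ => abs_nonneg _

theorem Image.card_row_changes_le {n : ℕ} (f : Image n Bool) (s : Fin n → Fin n) {t : ℝ}
    (ht : 0 < t) :
    ((Finset.univ.filter fun p : Fin n × Fin n => f (s p.1, p.2) ≠ f p).card : ℝ)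
      ≤ 3 * t * f.boundary.ncard + totalDisplacement s / t * n := by
  classical
  set far := Finset.univ.filter fun x : Fin n => t < |((s x).val : ℝ) - (x.val : ℝ)| with hfar
  set near := Finset.univ.filter fun p : Fin n × Fin n =>
    f (s p.1, p.2) ≠ f p ∧ |((s p.1).val : ℝ) - (p.1.val : ℝ)| ≤ t with hnear
  have hsub : (Finset.univ.filter fun p : Fin n × Fin n => f (s p.1, p.2) ≠ f p)
      ⊆ near ∪ far ×ˢ Finset.univ := by
    intro p hp
    simp only [Finset.mem_filter, Finset.mem_univ, true_and] at hp
    simp only [hnear, hfar, Finset.mem_union, Finset.mem_filter, Finset.mem_univ, true_and,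
      Finset.mem_product, and_true]
    rcases le_or_gt |((s p.1).val : ℝ) - (p.1.val : ℝ)| t with h | h
    · exact Or.inl ⟨hp, h⟩
    · exact Or.inr h
  have hcard : ((Finset.univ.filter fun p : Fin n × Fin n => f (s p.1, p.2) ≠ f p).card : ℝ)
      ≤ near.card + far.card * n := by
    have := (Finset.card_le_card hsub).trans (Finset.card_union_le _ _)
    rw [Finset.card_product, Finset.card_univ, Fintype.card_fin] at this
    exact_mod_cast this
  have h_far : (far.card : ℝ) * n ≤ totalDisplacement s / t * n :=
    mul_le_mul_of_nonneg_right (card_filter_lt_displacement s ht) (Nat.cast_nonneg n)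
  have h_near : (near.card : ℝ) ≤ 3 * t * f.boundary.ncard := by
    -- Displacements are integers, so for `t < 1` a near row does not move at all; for `t ≥ 1` the
    -- count `2 * t + 1` is at most `3 * t`.
    rcases lt_or_ge t 1 with ht1 | ht1
    · have : near = ∅ := by
        refine Finset.filter_eq_empty_iff.mpr fun p _ hp => hp.1 ?_
        have h1 : |((s p.1).val : ℝ) - (p.1.val : ℝ)| < 1 := hp.2.trans_lt ht1
        have h2 : |((s p.1).val : ℤ) - (p.1.val : ℤ)| < 1 := by exact_mod_cast h1
        rw [Int.abs_lt_one_iff] at h2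
        have h3 : s p.1 = p.1 := Fin.ext (by omega)
        rw [h3]
      rw [this, Finset.card_empty, Nat.cast_zero]
      positivity
    · have hfin : f.boundary.Finite := Set.toFinite _
      have hcover : near ⊆ hfin.toFinset.biUnion fun b =>
          (Finset.univ.filter fun x : Fin n => |(x.val : ℝ) - (b.1.val : ℝ)| ≤ t) ×ˢ {b.2} := by
        intro p hp
        obtain ⟨hne, hle⟩ := (Finset.mem_filter.mp hp).2
        obtain ⟨b, hb, hy, h1, h2⟩ := f.exists_boundary_between hne
        simp only [Finset.mem_biUnion, Set.Finite.mem_toFinset, Finset.mem_product,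
          Finset.mem_filter, Finset.mem_univ, true_and, Finset.mem_singleton]
        refine ⟨b, hb, le_trans ?_ hle, hy.symm⟩
        have h3 : |(p.1.val : ℤ) - (b.1.val : ℤ)| ≤ |((s p.1).val : ℤ) - (p.1.val : ℤ)| := by
          rw [min_le_iff, Fin.le_def, Fin.le_def] at h1
          rw [le_max_iff, Fin.le_def, Fin.le_def] at h2
          rw [abs_le]
          rcases abs_cases (((s p.1).val : ℤ) - (p.1.val : ℤ)) with h | h <;> omega
        exact_mod_cast h3
      calc (near.card : ℝ) ≤ ∑ b ∈ hfin.toFinset, (3 * t) := by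
            refine le_trans (Nat.cast_le.mpr ((Finset.card_le_card hcover).trans
              Finset.card_biUnion_le)) ?_
            rw [Nat.cast_sum]
            refine Finset.sum_le_sum fun b _ => ?_
            rw [Finset.card_product, Finset.card_singleton, mul_one]
            exact (card_filter_abs_sub_le b.1 ht.le).trans (by linarith)
        _ = 3 * t * f.boundary.ncard := by
            rw [Finset.sum_const, nsmul_eq_mul, Set.ncard_eq_toFinset_card _ hfin, mul_comm]
  linarith

/-- The transpose of an image. -/
def Image.transpose {n : ℕ} {C : Type*} (f : Image n C) : Image n C := fun p => f p.swap

theorem pixelNeighbor_swap {n : ℕ} {p q : Fin n × Fin n} :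
    PixelNeighbor p.swap q.swap ↔ PixelNeighbor p q := by
  simp only [PixelNeighbor, Prod.fst_swap, Prod.snd_swap]
  exact or_comm

theorem Image.ncard_boundary_transpose {n : ℕ} (f : Image n Bool) :
    f.transpose.boundary.ncard = f.boundary.ncard := by
  have : f.transpose.boundary = Prod.swap '' f.boundary := by
    ext p
    rw [Set.image_swap_eq_preimage_swap]
    refine and_congr Iff.rfl ⟨?_, ?_⟩
    · rintro ⟨q, hq, hf⟩
      exact ⟨q.swap, pixelNeighbor_swap.mpr hq, hf⟩
    · rintro ⟨q, hq, hf⟩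
      exact ⟨q.swap, by rwa [← pixelNeighbor_swap, Prod.swap_swap], by
        rwa [Image.transpose, Prod.swap_swap]⟩
  rw [this, Set.ncard_image_of_injective _ Prod.swap_injective]

theorem Image.card_column_changes_le {n : ℕ} (f : Image n Bool) (s : Fin n → Fin n) {t : ℝ}
    (ht : 0 < t) :
    ((Finset.univ.filter fun p : Fin n × Fin n => f (p.1, s p.2) ≠ f p).card : ℝ)
      ≤ 3 * t * f.boundary.ncard + totalDisplacement s / t * n := by
  rw [← f.ncard_boundary_transpose]
  refine le_trans ?_ (f.transpose.card_row_changes_le s ht)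
  norm_cast
  refine Finset.card_le_card_of_injOn Prod.swap (fun p hp => ?_) Prod.swap_injective.injOn
  have hp' := (Finset.mem_filter.mp hp).2
  exact Finset.mem_coe.mpr (Finset.mem_filter.mpr ⟨Finset.mem_univ _, hp'⟩)

/-- Compare through the intermediate colour `f (x, c y)`. Injectivity of `c` carries the row changes
seen in the columns `c y` back to row changes of `f`. -/
theorem Image.hammingDist_le_of_maps {n : ℕ} {f f' : Image n Bool} {r c : Fin n → Fin n}
    (hc : Function.Injective c) (h : ∀ x y, f' (x, y) = f (r x, c y)) {t : ℝ} (ht : 0 < t) :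
    (hammingDist f' f : ℝ)
      ≤ 6 * t * f.boundary.ncard + (totalDisplacement r + totalDisplacement c) / t * n := by
  classical
  have hsub : (Finset.univ.filter fun p : Fin n × Fin n => f' p ≠ f p)
      ⊆ (Finset.univ.filter fun p : Fin n × Fin n => f (r p.1, c p.2) ≠ f (p.1, c p.2))
        ∪ (Finset.univ.filter fun p : Fin n × Fin n => f (p.1, c p.2) ≠ f p) := by
    rintro ⟨x, y⟩ hp
    simp only [Finset.mem_filter, Finset.mem_univ, true_and, Finset.mem_union] at hp ⊢
    by_contra! hcon
    exact hp (by rw [h, hcon.1, hcon.2])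
  have h1 : (Finset.univ.filter fun p : Fin n × Fin n => f (r p.1, c p.2) ≠ f (p.1, c p.2)).card
      ≤ (Finset.univ.filter fun p : Fin n × Fin n => f (r p.1, p.2) ≠ f p).card := by
    refine Finset.card_le_card_of_injOn (fun p => (p.1, c p.2)) (fun p hp => ?_)
      fun p _ q _ hpq => ?_
    · simpa using hp
    · simp only [Prod.mk.injEq] at hpq
      exact Prod.ext hpq.1 (hc hpq.2)
  have h2 : hammingDist f' f ≤
      (Finset.univ.filter fun p : Fin n × Fin n => f (r p.1, p.2) ≠ f p).card
        + (Finset.univ.filter fun p : Fin n × Fin n => f (p.1, c p.2) ≠ f p).card :=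
    (Finset.card_le_card hsub).trans
      ((Finset.card_union_le _ _).trans (Nat.add_le_add_right h1 _))
  have h3 : (hammingDist f' f : ℝ) ≤
      (Finset.univ.filter fun p : Fin n × Fin n => f (r p.1, p.2) ≠ f p).card
        + (Finset.univ.filter fun p : Fin n × Fin n => f (p.1, c p.2) ≠ f p).card := by
    exact_mod_cast h2
  have h4 := f.card_row_changes_le r ht
  have h5 := f.card_column_changes_le c ht
  calc (hammingDist f' f : ℝ) ≤ _ := h3.trans (add_le_add h4 h5)
    _ = _ := by ring

/-! ### Sparse boundaries imply earthmover resilience -/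

theorem ImageProperty.HasSparseBoundary.isEarthmoverResilientWith {c : ℝ} (hc : 1 ≤ c)
    {P : ImageProperty Bool} (hP : P.HasSparseBoundary c)
    {δ : Set.Ioo (0 : ℝ) 1 → Set.Ioo (0 : ℝ) 1}
    (hδ : ∀ ε, (δ ε : ℝ) ≤ 1 / 192 * (ε : ℝ) ^ 2 / c ^ 2) :
    P.IsEarthmoverResilientWith δ := by
  intro ε n f hf f' hd
  refine ⟨f, hf, ?_⟩
  have hε := ε.2.1
  have hε1 := ε.2.2
  have hδ0 := (δ ε).2.1
  have hδε := hδ ε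
  set e : ℝ := (ε : ℝ)
  set d : ℝ := (δ ε : ℝ)
  unfold Image.relHammingDist
  rw [Fintype.card_prod, Fintype.card_fin]
  -- For `n = 0` the relative distance is `0 / 0 = 0`.
  rcases Nat.eq_zero_or_pos n with hn | hn
  · subst hn
    simpa using hε.le
  have hn' : (1 : ℝ) ≤ n := by exact_mod_cast hn
  rw [div_le_iff₀ (by push_cast; positivity)]
  have hchoose : (n + n).choose 2 ≠ 0 := (Nat.choose_pos (by omega)).ne'
  have hc0 : (((n + n).choose 2 : ℕ) : ℝ) ≤ 2 * (n : ℝ) ^ 2 := by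
    rw [Nat.cast_choose_two]
    push_cast
    nlinarith
  obtain ⟨L, hL, hlen⟩ := exists_moves_of_earthmoverDist_le hδ0.le hchoose hd
  obtain ⟨σ, hσ, hdisp⟩ := exists_perm_foldl_basicMove f.toGraph L
  have hdisp' : (totalDisplacement σ : ℝ) ≤ 4 * d * (n : ℝ) ^ 2 := by
    have h1 : (totalDisplacement σ : ℝ) ≤ 2 * (L.length : ℝ) := by exact_mod_cast hdisp
    nlinarith [mul_le_mul_of_nonneg_left hc0 hδ0.le]
  have hd_c : d * (192 * c ^ 2) ≤ e ^ 2 := by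
    have : 1 / 192 * e ^ 2 / c ^ 2 = e ^ 2 / (192 * c ^ 2) := by
      field_simp
    rw [this, le_div_iff₀ (by positivity)] at hδε
    exact hδε
  have hd1 : d * 192 ≤ 1 := by nlinarith
  have hsmall : 2 * totalDisplacement σ < (n : ℤ) ^ 2 := by
    have : 2 * (totalDisplacement σ : ℝ) < (n : ℝ) ^ 2 := by nlinarith
    exact_mod_cast this
  obtain ⟨r, s, hs, hf', hsum⟩ := Image.exists_maps_of_toGraph_eq (f := f) (f' := f')
    (fun u => by rw [← hσ u, hL]) hsmall
  -- This threshold makes the boundary term `6 * t * (c * n)` exactly half of `e * n ^ 2`.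
  have ht : 0 < e * n / (12 * c) := by positivity
  have hbound := Image.hammingDist_le_of_maps hs hf' ht
  have hsum' : (totalDisplacement r : ℝ) + totalDisplacement s = totalDisplacement σ := by
    exact_mod_cast hsum
  rw [hsum'] at hbound
  have hB := hP n f hf
  have hfirst : 6 * (e * n / (12 * c)) * f.boundary.ncard ≤ e * (n : ℝ) ^ 2 / 2 := by
    calc 6 * (e * n / (12 * c)) * f.boundary.ncard ≤ 6 * (e * n / (12 * c)) * (c * n) :=
          mul_le_mul_of_nonneg_left hB (by positivity)
      _ = e * (n : ℝ) ^ 2 / 2 := by field_simp; ring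
  have hsecond : totalDisplacement σ / (e * n / (12 * c)) * n ≤ e * (n : ℝ) ^ 2 / 2 := by
    calc totalDisplacement σ / (e * n / (12 * c)) * n
        ≤ 4 * d * (n : ℝ) ^ 2 / (e * n / (12 * c)) * n := by gcongr
      _ = 48 * d * c * (n : ℝ) ^ 2 / e := by field_simp; ring
      _ ≤ e * (n : ℝ) ^ 2 / 2 := by
          rw [div_le_iff₀ hε]
          -- Only a bound linear in `c` is required here; `c ≤ c ^ 2` and `192 ≥ 96` leave slack.
          have : d * c * 96 ≤ e ^ 2 := by
            have : d * c ≤ d * c ^ 2 := mul_le_mul_of_nonneg_left (by nlinarith) hδ0.le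
            nlinarith [mul_pos hδ0 (lt_of_lt_of_le one_pos hc)]
          nlinarith [mul_le_mul_of_nonneg_right this (sq_nonneg (n : ℝ))]
  push_cast
  calc (hammingDist f' f : ℝ) ≤ e * (n : ℝ) ^ 2 / 2 + e * (n : ℝ) ^ 2 / 2 :=
        hbound.trans (add_le_add hfirst hsecond)
    _ = e * ((n : ℝ) * n) := by ring

theorem ImageProperty.HasSparseBoundary.isEarthmoverResilient {c : ℝ} (hc : 1 ≤ c)
    {P : ImageProperty Bool} (hP : P.HasSparseBoundary c) : P.IsEarthmoverResilient := by
  have hle : ∀ ε : Set.Ioo (0 : ℝ) 1, 1 / 192 * (ε : ℝ) ^ 2 / c ^ 2 < 1 := fun ε => by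
    have h0 := ε.2.1
    have h1 := ε.2.2
    rw [div_lt_one (by positivity)]
    nlinarith
  exact ⟨fun ε => ⟨1 / 192 * (ε : ℝ) ^ 2 / c ^ 2, by have := ε.2.1; positivity, hle ε⟩,
    hP.isEarthmoverResilientWith hc fun _ => le_rfl⟩

/-! ### Convex images and half-planes -/

/-- The black pixels are consecutive in every line parallel to an axis. -/
def Image.IsLineConvex {n : ℕ} (f : Image n Bool) : Prop :=
  (∀ x y z w : Fin n, x ≤ y → y ≤ z → f (x, w) = true → f (z, w) = true → f (y, w) = true) ∧
  (∀ x y z w : Fin n, x ≤ y → y ≤ z → f (w, x) = true → f (w, z) = true → f (w, y) = true)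

theorem Image.IsLineConvex.transpose {n : ℕ} {f : Image n Bool} (hf : f.IsLineConvex) :
    f.transpose.IsLineConvex :=
  ⟨hf.2, hf.1⟩

theorem Image.IsLineConvex.ncard_rows_le {n : ℕ} {f : Image n Bool} (hf : f.IsLineConvex) :
    {p : Fin n × Fin n | f p = true ∧ ∃ q, (p.2 = q.2 ∧
      (p.1.val + 1 = q.1.val ∨ q.1.val + 1 = p.1.val)) ∧ f q = false}.ncard ≤ 2 * n := by
  have hline : ∀ x y z w : Fin n, f (x, w) = true → f (z, w) = true → f (y, w) = false →
      ¬ (x.val ≤ y.val ∧ y.val ≤ z.val) := by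
    intro x y z w hx hz hy h
    rw [hf.1 x y z w h.1 h.2 hx hz] at hy
    exact absurd hy (by decide)
  -- `R` is one of the two directions along a line. If two black pixels of one line both had a white
  -- neighbour in direction `R`, one of these neighbours would lie between them, against line
  -- convexity. So each line contributes at most one pixel per direction.
  have hone : ∀ R : Fin n → Fin n → Prop,
      (∀ x x' y y' : Fin n, x < x' → R x y → R x' y' → ¬ (x.val ≤ y.val ∧ y.val ≤ x'.val) →
        ¬ (x.val ≤ y'.val ∧ y'.val ≤ x'.val) → False) →
      {p : Fin n × Fin n | f p = true ∧ ∃ y, R p.1 y ∧ f (y, p.2) = false}.ncard ≤ n := by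
    intro R hR
    have hinj : Set.InjOn (Prod.snd : Fin n × Fin n → Fin n)
        {p : Fin n × Fin n | f p = true ∧ ∃ y, R p.1 y ∧ f (y, p.2) = false} := by
      rintro ⟨x, w⟩ ⟨hx, y, hxy, hy⟩ ⟨x', w'⟩ ⟨hx', y', hxy', hy'⟩ (rfl : w = w')
      rcases lt_trichotomy x x' with h | h | h
      · exact (hR x x' y y' h hxy hxy' (hline _ _ _ w hx hx' hy) (hline _ _ _ w hx hx' hy')).elim
      · rw [h]
      · exact (hR x' x y' y h hxy' hxy (hline _ _ _ w hx' hx hy') (hline _ _ _ w hx' hx hy)).elim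
    calc _ ≤ (Set.univ : Set (Fin n)).ncard :=
          Set.ncard_le_ncard_of_injOn Prod.snd (fun _ _ => Set.mem_univ _) hinj
      _ = n := by simp [Set.ncard_univ]
  have h1 := hone (fun x y => x.val + 1 = y.val) (by intros; omega)
  have h2 := hone (fun x y => y.val + 1 = x.val) (by intros; omega)
  refine le_trans (Set.ncard_le_ncard (t := _ ∪ _) ?_ (Set.toFinite _))
    ((Set.ncard_union_le _ _).trans ((add_le_add h1 h2).trans (two_mul n).ge))
  rintro p ⟨hp, q, ⟨hw, hq | hq⟩, hfq⟩
  · exact Or.inl ⟨hp, q.1, hq, by rwa [hw]⟩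
  · exact Or.inr ⟨hp, q.1, hq, by rwa [hw]⟩

theorem Image.IsLineConvex.ncard_boundary_le {n : ℕ} {f : Image n Bool} (hf : f.IsLineConvex) :
    f.boundary.ncard ≤ 4 * n := by
  have h1 := hf.ncard_rows_le
  have h2 := hf.transpose.ncard_rows_le
  rw [← Set.ncard_image_of_injective _ (Prod.swap_injective (α := Fin n) (β := Fin n))] at h2
  refine le_trans (Set.ncard_le_ncard (t := _ ∪ _) ?_ (Set.toFinite _))
    ((Set.ncard_union_le _ _).trans ((add_le_add h1 h2).trans (by omega)))
  rintro p ⟨hp, q, hq | hq, hfq⟩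
  · exact Or.inr ⟨p.swap, ⟨hp, q.swap, hq, hfq⟩, p.swap_swap⟩
  · exact Or.inl ⟨hp, q, hq, hfq⟩

theorem isLineConvex_of_mem_convexImages {n : ℕ} {f : Image n Bool} (hf : f ∈ convexImages n) :
    f.IsLineConvex := by
  have key : ∀ p q r : Fin n × Fin n, f p = true → f r = true →
      pixelPoint q ∈ segment ℝ (pixelPoint p) (pixelPoint r) → f q = true := by
    intro p q r hp hr hq
    have hp' : pixelPoint p ∈ pixelPoint '' {p | f p = true} := ⟨p, hp, rfl⟩
    have hr' : pixelPoint r ∈ pixelPoint '' {p | f p = true} := ⟨r, hr, rfl⟩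
    exact hf q (segment_subset_convexHull hp' hr' hq)
  refine ⟨fun x y z w hxy hyz hx hz => key _ (y, w) _ hx hz ?_,
    fun x y z w hxy hyz hx hz => key _ (w, y) _ hx hz ?_⟩
  all_goals
    have h1 : (x.val : ℝ) ≤ y.val := by exact_mod_cast hxy
    have h2 : (y.val : ℝ) ≤ z.val := by exact_mod_cast hyz
    have hseg : (y.val : ℝ) ∈ segment ℝ (x.val : ℝ) (z.val : ℝ) := by
      rw [segment_eq_Icc (h1.trans h2)]
      exact ⟨h1, h2⟩
  · unfold pixelPoint
    rw [← Prod.image_mk_segment_left]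
    exact ⟨_, hseg, rfl⟩
  · unfold pixelPoint
    rw [← Prod.image_mk_segment_right]
    exact ⟨_, hseg, rfl⟩

theorem convexImages_hasSparseBoundary : convexImages.HasSparseBoundary 4 := fun _ _ hf => by
  exact_mod_cast (isLineConvex_of_mem_convexImages hf).ncard_boundary_le

/-- A closed half-plane is convex, so it contains the convex hull of its black pixels. -/
theorem halfPlaneImages_subset_convexImages (n : ℕ) : halfPlaneImages n ⊆ convexImages n := by
  rintro f ⟨a, b, t, -, h⟩ q hq
  have hconv : Convex ℝ {v : ℝ × ℝ | t ≤ a * v.1 + b * v.2} :=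
    convex_halfSpace_ge (f := fun v : ℝ × ℝ => a * v.1 + b * v.2)
      ⟨fun u v => by simp only [Prod.fst_add, Prod.snd_add]; ring,
        fun r v => by simp only [Prod.smul_fst, Prod.smul_snd, smul_eq_mul]; ring⟩ t
  refine (h q).mpr (convexHull_min ?_ hconv hq)
  rintro _ ⟨p, hp, rfl⟩
  exact (h p).mp hp

theorem halfPlaneImages_hasSparseBoundary : halfPlaneImages.HasSparseBoundary 4 :=
  fun n f hf => convexImages_hasSparseBoundary n f (halfPlaneImages_subset_convexImages n hf)

theorem mainTheorem7 :
    (∃ α : ℝ, 0 < α ∧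
      ∀ (c : ℝ), 1 ≤ c → ∀ P : ImageProperty Bool, P.HasSparseBoundary c →
        ∀ δ : Set.Ioo (0 : ℝ) 1 → Set.Ioo (0 : ℝ) 1,
          (∀ ε, (δ ε : ℝ) ≤ α * (ε : ℝ) ^ 2 / c ^ 2) → P.IsEarthmoverResilientWith δ) ∧
    (convexImages.HasSparseBoundary 4 ∧ convexImages.IsEarthmoverResilient) ∧
    (halfPlaneImages.HasSparseBoundary 4 ∧ halfPlaneImages.IsEarthmoverResilient) :=
  ⟨⟨1 / 192, by norm_num, fun _ hc _ hP _ hδ => hP.isEarthmoverResilientWith hc hδ⟩,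
    ⟨convexImages_hasSparseBoundary,
      convexImages_hasSparseBoundary.isEarthmoverResilient (by norm_num)⟩,
    ⟨halfPlaneImages_hasSparseBoundary,
      halfPlaneImages_hasSparseBoundary.isEarthmoverResilient (by norm_num)⟩⟩
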